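/- An $\alpha$-stationary surface ($\alpha\in\mathbb R$) is a smooth immersion $X\colon\Sigma\to\mathbb R^3\setminus\{0\}$ of a connected smooth surface $\Sigma$ (possibly with boundary) such that, identifying $p\in\Sigma$ with its image, $$H(p)=\alpha\,\frac{\langle \nu(p),p\rangle}{|p|^2}\qquad (p\in\Sigma),$$ where $\nu(p)$ is a unit normal vector at $p$ and $H$ is the sum of the principal curvatures with respect to $\nu$, with the sign convention that a sphere of radius $r$ has $H=2/r$ for the inward normal (the equation does not depend on the choice of $\pm\nu$). The surface spans a curve $\Gamma$ if $X(\partial\Sigma)=\Gamma$. **Theorem.** Let $P\subset\mathbb R^3$ be a vector plane (a two-dimensional linear subspace), let $\Gamma\subset P$ be a circle of positive radius, and let $D\subset P$ be the closed planar disc bounded by $\Gamma$. Assume $0\notin D$. Then $D$ is the only compact $-4$-stationary surface spanning $\Gamma$. That is: 1. $D$, included in $\mathbb R^3$, is a compact $-4$-stationary surface spanning $\Gamma$; 2. if $X\colon\Sigma\to\mathbb R^3$ is any compact $-4$-stationary surface spanning $\Gamma$, then $X$ is injective and $X(\Sigma)=D$. -/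

import Mathlib

open scoped Manifold ContDiff

noncomputable section

namespace StationarySurface

/-- Euclidean 3-space. -/
abbrev E3 := EuclideanSpace ℝ (Fin 3)

/-- The parameter plane, which contains the model half-plane of surfaces with boundary. -/
abbrev E2 := EuclideanSpace ℝ (Fin 2)

/-- The circle with centre `c` and radius `r` in the plane `P`. -/
def circleIn (P : Submodule ℝ E3) (c : E3) (r : ℝ) : Set E3 :=
  {p | p ∈ P ∧ dist p c = r}

/-- The closed disc with centre `c` and radius `r` in the plane `P`. -/
def discIn (P : Submodule ℝ E3) (c : E3) (r : ℝ) : Set E3 :=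
  {p | p ∈ P ∧ dist p c ≤ r}

section LocalGeometry

variable {M : Type*} [TopologicalSpace M] [ChartedSpace (EuclideanHalfSpace 2) M]

/-- The map `X : M → ℝ³` read in the chart of the surface `M` at `x`: a local parametrization,
meaningful on a relatively open subset of the closed half-plane `Set.range (𝓡∂ 2)`. -/
def localParam (X : M → E3) (x : M) : E2 → E3 :=
  X ∘ (extChartAt (𝓡∂ 2) x).symm

/-- The first partial derivatives `X_{u_i}` of the local parametrization, as functions of the
parameter. The derivatives are taken within the closed half-plane, so that they are one-sided at
boundary points and the usual ones at interior points. -/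
def partialDeriv (X : M → E3) (x : M) (i : Fin 2) (u : E2) : E3 :=
  fderivWithin ℝ (localParam X x) (Set.range (𝓡∂ 2)) u (EuclideanSpace.single i 1)

/-- The tangent vector `X_{u_i}` at the point `x`. -/
def tangentVec (X : M → E3) (x : M) (i : Fin 2) : E3 :=
  partialDeriv X x i (extChartAt (𝓡∂ 2) x x)

/-- The second partial derivative `X_{u_i u_j}` at the point `x`. -/
def secondDeriv (X : M → E3) (x : M) (i j : Fin 2) : E3 :=
  fderivWithin ℝ (partialDeriv X x j) (Set.range (𝓡∂ 2)) (extChartAt (𝓡∂ 2) x x)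
    (EuclideanSpace.single i 1)

/-- Coefficients `g_{ij} = ⟨X_{u_i}, X_{u_j}⟩` of the first fundamental form at `x`. -/
def firstForm (X : M → E3) (x : M) (i j : Fin 2) : ℝ :=
  inner ℝ (tangentVec X x i) (tangentVec X x j)

/-- Coefficients `h_{ij} = ⟨X_{u_i u_j}, ν⟩` of the second fundamental form at `x` with respect to
the unit normal vector `ν`. -/
def secondForm (X : M → E3) (x : M) (ν : E3) (i j : Fin 2) : ℝ :=
  inner ℝ (secondDeriv X x i j) ν

/-- The mean curvature at `x` with respect to the unit normal `ν`: the sum of the principal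
curvatures, that is, the trace of the second fundamental form with respect to the first one. A
sphere of radius `r` has mean curvature `2 / r` with respect to the inward normal. -/
def meanCurvature (X : M → E3) (x : M) (ν : E3) : ℝ :=
  (firstForm X x 1 1 * secondForm X x ν 0 0 - 2 * firstForm X x 0 1 * secondForm X x ν 0 1
      + firstForm X x 0 0 * secondForm X x ν 1 1) /
    (firstForm X x 0 0 * firstForm X x 1 1 - firstForm X x 0 1 ^ 2)

/-- `ν` is one of the two unit vectors normal to the surface at `x`. -/
def IsUnitNormal (X : M → E3) (x : M) (ν : E3) : Prop :=
  ‖ν‖ = 1 ∧ ∀ i : Fin 2, inner ℝ (tangentVec X x i) ν = 0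

/-- A smooth immersion into `ℝ³` of the surface with boundary `M`. -/
def IsSmoothImmersion (X : M → E3) : Prop :=
  ContMDiff (𝓡∂ 2) 𝓘(ℝ, E3) ∞ X ∧
    ∀ x : M, Function.Injective (mfderiv (𝓡∂ 2) 𝓘(ℝ, E3) X x)

/-- The equation `H = α ⟨ν, p⟩ / |p|²` on a surface in `ℝ³ ∖ {0}`. Both sides change sign with `ν`,
so the equation does not depend on the choice of the unit normal and is meaningful without an
orientation. -/
def IsStationary (α : ℝ) (X : M → E3) : Prop :=
  (∀ x : M, X x ≠ 0) ∧
    ∀ (x : M) (ν : E3), IsUnitNormal X x ν →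
      meanCurvature X x ν = α * (inner ℝ ν (X x) / ‖X x‖ ^ 2)

/-- `X : M → ℝ³` is a compact `α`-stationary surface: `M` is a compact connected smooth surface,
possibly with boundary, and `X` is a smooth immersion of `M` that avoids the origin and satisfies
the equation `H = α ⟨ν, p⟩ / |p|²`. -/
structure IsCompactStationarySurface (α : ℝ) (X : M → E3) : Prop where
  isManifold : IsManifold (𝓡∂ 2) ∞ M
  t2 : T2Space M
  compact : CompactSpace M
  connected : ConnectedSpace M
  immersion : IsSmoothImmersion X
  stationary : IsStationary α X

/-- The surface `X : M → ℝ³` spans `Γ`: its boundary is mapped onto `Γ`. -/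
def Spans (X : M → E3) (Γ : Set E3) : Prop :=
  X '' (𝓡∂ 2).boundary M = Γ

end LocalGeometry

end StationarySurface

end

namespace StationarySurface

open Set Filter Topology

noncomputable section

/-! ### The second derivative test -/

/-! Uniqueness rests on a maximum principle. The inversion `q = p / |p|²` turns `-4`-stationary
surfaces into minimal ones and `(⟨p, n⟩ + ε) / |p|²` into `⟨q, n⟩ + ε |q|²`, which is strictly
subharmonic on a minimal surface when `ε > 0`. So such a function has no interior maximum;
`not_isLocalMax_of_interior` checks this directly, without inverting.

Taking `±n` normal to `P` and a suitable `ε` confines the surface to `P`. Taking `n = -2c` and `ε =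
|c|² - r²`, positive because `0 ∉ D`, confines it to the ball with centre `c` and radius `r`
(`mem_discIn_of_spans`).

A compact surface immersed in `D` whose boundary goes to the circle is locally homeomorphic to `D`,
also at the boundary, hence covers it. As `D` is convex, the covering is trivial
(`bijOn_convex_of_locally_injective`).

Conversely, on a surface in `P` both sides of the equation vanish. It remains to make `D` a surface
with boundary, by two Cayley transforms onto a half-plane. -/

theorem IsLocalMax.deriv_deriv_nonpos {f : ℝ → ℝ} {a : ℝ} (h : IsLocalMax f a)
    (hc : ContinuousAt f a) : deriv (deriv f) a ≤ 0 := by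
  by_contra! hpos
  -- A local maximum that is also a local minimum forces `f` to be locally constant, so the second
  -- derivative is zero.
  have hmin := isLocalMin_of_deriv_deriv_pos hpos h.deriv_eq_zero hc
  have hconst : f =ᶠ[𝓝 a] fun _ => f a := by
    filter_upwards [h, hmin] with x h₁ h₂ using le_antisymm h₁ h₂
  have : deriv (deriv f) a = 0 := by
    rw [hconst.deriv.deriv_eq]
    simp
  exact hpos.ne' this

section Hessian

variable {E F : Type*} [NormedAddCommGroup E] [NormedSpace ℝ E]
  [NormedAddCommGroup F] [InnerProductSpace ℝ F]

/-- First and second order conditions at a local maximum of `⟨ψ, n⟩ - m |ψ|²`. -/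
theorem isLocalMax_inner_sub_norm_sq {ψ : E → F} {u : E} (hψ : ContDiffAt ℝ 2 ψ u) {n : F} {m : ℝ}
    (h : IsLocalMax (fun y => inner ℝ (ψ y) n - m * ‖ψ y‖ ^ 2) u) (v : E) :
    inner ℝ (fderiv ℝ ψ u v) (n - (2 * m) • ψ u) = 0 ∧
      inner ℝ (fderiv ℝ (fderiv ℝ ψ) u v v) (n - (2 * m) • ψ u)
        - 2 * m * ‖fderiv ℝ ψ u v‖ ^ 2 ≤ 0 := by
  set γ : ℝ → E := fun t => u + t • v with hγ
  have hγ0 : γ 0 = u := by simp [hγ]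
  have hγd : ∀ t, HasDerivAt γ v t := fun t => by
    simpa [hγ] using (((hasDerivAt_id t).smul_const v).const_add u)
  have hγc : Tendsto γ (𝓝 0) (𝓝 u) := by
    have := (hγd 0).continuousAt.tendsto
    rwa [hγ0] at this
  set g : ℝ → ℝ := fun t => inner ℝ (ψ (γ t)) n - m * ‖ψ (γ t)‖ ^ 2 with hg
  have hmax : IsLocalMax g 0 := by
    have := hγc.eventually h
    simpa [IsLocalMax, IsMaxFilter, hg, hγ0] using this
  have hev : ∀ᶠ y in 𝓝 u, ContDiffAt ℝ 2 ψ y := hψ.eventually (by simp)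
  have hψd : ∀ y, ContDiffAt ℝ 2 ψ y → HasFDerivAt ψ (fderiv ℝ ψ y) y := fun y hy =>
    (hy.differentiableAt (by simp)).hasFDerivAt
  have hd1 : ∀ t, ContDiffAt ℝ 2 ψ (γ t) → HasDerivAt g
      (inner ℝ (fderiv ℝ ψ (γ t) v) (n - (2 * m) • ψ (γ t))) t := by
    intro t ht
    have h1 : HasDerivAt (fun s => ψ (γ s)) (fderiv ℝ ψ (γ t) v) t :=
      (hψd _ ht).comp_hasDerivAt t (hγd t)
    have h2 := (h1.inner ℝ (hasDerivAt_const t n)).sub ((h1.norm_sq).const_mul m)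
    refine h2.congr_deriv ?_
    rw [inner_sub_right, inner_smul_right, real_inner_comm (ψ (γ t))]
    simp
    ring
  have hcd : ContDiffAt ℝ 2 ψ (γ 0) := by rwa [hγ0]
  have hD : DifferentiableAt ℝ (fderiv ℝ ψ) u :=
    (hψ.fderiv_right (m := 1) (by norm_num)).differentiableAt (by simp)
  have hfirst := (hd1 0 hcd).deriv
  rw [hmax.deriv_eq_zero, hγ0] at hfirst
  have hderiv : deriv g =ᶠ[𝓝 0]
      fun t => inner ℝ (fderiv ℝ ψ (γ t) v) (n - (2 * m) • ψ (γ t)) := by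
    filter_upwards [hγc.eventually hev] with t ht using (hd1 t ht).deriv
  have h2 : HasDerivAt (fun t => inner ℝ (fderiv ℝ ψ (γ t) v) (n - (2 * m) • ψ (γ t)))
      (inner ℝ (fderiv ℝ (fderiv ℝ ψ) u v v) (n - (2 * m) • ψ u)
        - 2 * m * ‖fderiv ℝ ψ u v‖ ^ 2) 0 := by
    have h1 : HasDerivAt (fun s => ψ (γ s)) (fderiv ℝ ψ (γ 0) v) 0 :=
      (hψd _ hcd).comp_hasDerivAt 0 (hγd 0)
    have hD' : HasFDerivAt (fderiv ℝ ψ) (fderiv ℝ (fderiv ℝ ψ) u) (γ 0) := by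
      rw [hγ0]; exact hD.hasFDerivAt
    have h3 : HasDerivAt (fun s => fderiv ℝ ψ (γ s)) (fderiv ℝ (fderiv ℝ ψ) u v) 0 :=
      hD'.comp_hasDerivAt 0 (hγd 0)
    have h4 : HasDerivAt (fun s => fderiv ℝ ψ (γ s) v) (fderiv ℝ (fderiv ℝ ψ) u v v) 0 := by
      simpa using h3.clm_apply (hasDerivAt_const 0 v)
    have h5 : HasDerivAt (fun s => n - (2 * m) • ψ (γ s)) (-((2 * m) • fderiv ℝ ψ (γ 0) v)) 0 :=
      (h1.const_smul (2 * m)).const_sub n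
    refine (h4.inner ℝ h5).congr_deriv ?_
    rw [hγ0, inner_neg_right, inner_smul_right, real_inner_self_eq_norm_sq]
    ring
  refine ⟨hfirst.symm, ?_⟩
  rw [← h2.deriv, ← hderiv.deriv_eq]
  exact IsLocalMax.deriv_deriv_nonpos hmax (hd1 0 hcd).continuousAt

end Hessian

/-! ### Mean curvature and the maximum principle. -/

section Local

variable {M : Type*} [TopologicalSpace M] [ChartedSpace (EuclideanHalfSpace 2) M] {X : M → E3}

theorem contDiffWithinAt_localParam (hX : ContMDiff (𝓡∂ 2) 𝓘(ℝ, E3) ∞ X) (x : M) :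
    ContDiffWithinAt ℝ ∞ (localParam X x) (range (𝓡∂ 2)) (extChartAt (𝓡∂ 2) x x) :=
  (contMDiffAt_iff.1 (hX x)).2

theorem mfderiv_eq_fderivWithin_localParam (hX : ContMDiff (𝓡∂ 2) 𝓘(ℝ, E3) ∞ X) (x : M) :
    mfderiv (𝓡∂ 2) 𝓘(ℝ, E3) X x =
      fderivWithin ℝ (localParam X x) (range (𝓡∂ 2)) (extChartAt (𝓡∂ 2) x x) := by
  rw [((hX x).mdifferentiableAt (by simp)).mfderiv]
  rfl

theorem range_mem_nhds_of_interior {x : M} (hx : (𝓡∂ 2).IsInteriorPoint x) :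
    range (𝓡∂ 2) ∈ 𝓝 (extChartAt (𝓡∂ 2) x x) :=
  mem_interior_iff_mem_nhds.1 hx

theorem contDiffAt_localParam (hX : ContMDiff (𝓡∂ 2) 𝓘(ℝ, E3) ∞ X) {x : M}
    (hx : (𝓡∂ 2).IsInteriorPoint x) :
    ContDiffAt ℝ ∞ (localParam X x) (extChartAt (𝓡∂ 2) x x) :=
  (contDiffWithinAt_localParam hX x).contDiffAt (range_mem_nhds_of_interior hx)

theorem tangentVec_eq_fderiv {x : M} (hx : (𝓡∂ 2).IsInteriorPoint x) (i : Fin 2) :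
    tangentVec X x i = fderiv ℝ (localParam X x) (extChartAt (𝓡∂ 2) x x)
      (EuclideanSpace.single i 1) := by
  rw [tangentVec, partialDeriv, fderivWithin_of_mem_nhds (range_mem_nhds_of_interior hx)]

theorem secondDeriv_eq_fderiv (hX : ContMDiff (𝓡∂ 2) 𝓘(ℝ, E3) ∞ X) {x : M}
    (hx : (𝓡∂ 2).IsInteriorPoint x) (i j : Fin 2) :
    secondDeriv X x i j = fderiv ℝ (fderiv ℝ (localParam X x)) (extChartAt (𝓡∂ 2) x x)
      (EuclideanSpace.single i 1) (EuclideanSpace.single j 1) := by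
  have hr := range_mem_nhds_of_interior hx
  have hD : DifferentiableAt ℝ (fderiv ℝ (localParam X x)) (extChartAt (𝓡∂ 2) x x) :=
    ((contDiffAt_localParam hX hx).fderiv_right (m := 1) (by norm_cast)).differentiableAt
      (by norm_num)
  rw [secondDeriv, fderivWithin_of_mem_nhds hr]
  have heq : partialDeriv X x j =ᶠ[𝓝 (extChartAt (𝓡∂ 2) x x)]
      fun u => fderiv ℝ (localParam X x) u (EuclideanSpace.single j 1) := by
    filter_upwards [eventually_mem_nhds_iff.2 hr] with u hu
    rw [partialDeriv, fderivWithin_of_mem_nhds hu]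
  rw [heq.fderiv_eq, fderiv_clm_apply hD (differentiableAt_const _)]
  simp

theorem linearIndependent_tangentVec (hX : IsSmoothImmersion X) (x : M) :
    LinearIndependent ℝ (tangentVec X x) := by
  have hinj := hX.2 x
  rw [mfderiv_eq_fderivWithin_localParam hX.1 x] at hinj
  have hb := (EuclideanSpace.basisFun (Fin 2) ℝ).toBasis.linearIndependent
  have := hb.map' (fderivWithin ℝ (localParam X x) (range (𝓡∂ 2))
    (extChartAt (𝓡∂ 2) x x)).toLinearMap (LinearMap.ker_eq_bot.2 hinj)
  have heq : tangentVec X x = (fderivWithin ℝ (localParam X x) (range (𝓡∂ 2))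
      (extChartAt (𝓡∂ 2) x x)).toLinearMap ∘ (EuclideanSpace.basisFun (Fin 2) ℝ).toBasis := by
    ext1 i
    simp [tangentVec, partialDeriv]
  rw [heq]
  exact this

theorem firstForm_self_pos (hX : IsSmoothImmersion X) (x : M) (i : Fin 2) :
    0 < firstForm X x i i :=
  real_inner_self_pos.2 ((linearIndependent_tangentVec hX x).ne_zero i)

/-- The vector `g₀₀ b - g₀₁ a` is nonzero by independence, and its squared norm is `g₀₀` times the
determinant. -/
theorem firstForm_det_pos (hX : IsSmoothImmersion X) (x : M) :
    0 < firstForm X x 0 0 * firstForm X x 1 1 - firstForm X x 0 1 ^ 2 := by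
  have hli := linearIndependent_tangentVec hX x
  have h0 := firstForm_self_pos hX x 0
  set a := tangentVec X x 0 with ha
  set b := tangentVec X x 1 with hb
  have hne : firstForm X x 0 0 • b - firstForm X x 0 1 • a ≠ 0 := by
    intro h
    have h2 := Fintype.linearIndependent_iff.1 hli ![-firstForm X x 0 1, firstForm X x 0 0] (by
      simp only [Fin.sum_univ_two, Matrix.cons_val_zero, Matrix.cons_val_one, ← ha, ← hb, ← h]
      module)
    exact h0.ne' (h2 1)
  have hpos := real_inner_self_pos.2 hne
  have hexp : inner ℝ (firstForm X x 0 0 • b - firstForm X x 0 1 • a)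
      (firstForm X x 0 0 • b - firstForm X x 0 1 • a) =
      firstForm X x 0 0 * (firstForm X x 0 0 * firstForm X x 1 1 - firstForm X x 0 1 ^ 2) := by
    simp only [inner_sub_left, inner_sub_right, inner_smul_left, inner_smul_right]
    have e0 : inner ℝ a a = firstForm X x 0 0 := rfl
    have e1 : inner ℝ b b = firstForm X x 1 1 := rfl
    have e2 : inner ℝ a b = firstForm X x 0 1 := rfl
    have e3 : inner ℝ b a = firstForm X x 0 1 := real_inner_comm _ _
    rw [e0, e1, e2, e3]
    simp
    ring
  rw [hexp] at hpos
  exact (pos_iff_pos_of_mul_pos hpos).1 h0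

/-- The stationarity equation, tested against an arbitrary normal vector. -/
theorem trace_inner_secondDeriv {α : ℝ} (hX : IsSmoothImmersion X) (hs : IsStationary α X) (x : M)
    {w : E3} (hw : ∀ i, inner ℝ (tangentVec X x i) w = 0) :
    firstForm X x 1 1 * inner ℝ (secondDeriv X x 0 0) w
        - 2 * firstForm X x 0 1 * inner ℝ (secondDeriv X x 0 1) w
        + firstForm X x 0 0 * inner ℝ (secondDeriv X x 1 1) w =
      (firstForm X x 0 0 * firstForm X x 1 1 - firstForm X x 0 1 ^ 2) *
        (α * (inner ℝ w (X x) / ‖X x‖ ^ 2)) := by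
  rcases eq_or_ne w 0 with rfl | hw0
  · simp
  have hn : ‖w‖ ≠ 0 := norm_ne_zero_iff.2 hw0
  have hν : IsUnitNormal X x (‖w‖⁻¹ • w) := by
    refine ⟨by rw [norm_smul, norm_inv, norm_norm, inv_mul_cancel₀ hn], fun i => ?_⟩
    rw [inner_smul_right, hw i, mul_zero]
  have h := hs.2 x _ hν
  have hdet := (firstForm_det_pos hX x).ne'
  rw [meanCurvature, div_eq_iff hdet] at h
  simp only [secondForm, inner_smul_right, inner_smul_left] at h
  have h' := congrArg (fun z => ‖w‖ * z) h
  simp only [conj_trivial] at h'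
  field_simp at h' ⊢
  linarith

/-- The functions `(⟨p, n⟩ + ε) / |p|²` with `ε > 0` have no local maximum at an interior point of a
`-4`-stationary surface. -/
theorem not_isLocalMax_of_interior (hX : IsSmoothImmersion X) (hs : IsStationary (-4) X) {x : M}
    (hx : (𝓡∂ 2).IsInteriorPoint x) (n : E3) {ε : ℝ} (hε : 0 < ε) :
    ¬ IsLocalMax (fun y => (inner ℝ (X y) n + ε) / ‖X y‖ ^ 2) x := by
  intro hmax
  set u := extChartAt (𝓡∂ 2) x x with hu
  set ψ := localParam X x with hψ
  set m := (inner ℝ (X x) n + ε) / ‖X x‖ ^ 2 with hm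
  have hpos : ∀ y, 0 < ‖X y‖ ^ 2 := fun y => pow_pos (norm_pos_iff.2 (hs.1 y)) 2
  have hψu : ψ u = X x := congrArg X (extChartAt_to_inv (I := 𝓡∂ 2) x)
  have hmX : m * ‖X x‖ ^ 2 = inner ℝ (X x) n + ε := div_mul_cancel₀ _ (hpos x).ne'
  have hcd := contDiffAt_localParam hX.1 hx
  have hcd2 : ContDiffAt ℝ 2 ψ u := hcd.of_le (by norm_cast)
  -- Clearing the denominator with `m` frozen at the maximal value leaves a quadratic function of
  -- `ψ`, with maximum `-ε`.
  have hloc : IsLocalMax (fun y => inner ℝ (ψ y) n - m * ‖ψ y‖ ^ 2) u := by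
    have hmax' : ∀ᶠ y in 𝓝 x, inner ℝ (X y) n - m * ‖X y‖ ^ 2 ≤ -ε := by
      filter_upwards [hmax] with y hy
      have := (div_le_iff₀ (hpos y)).1 hy
      linarith
    have ht : Tendsto (extChartAt (𝓡∂ 2) x).symm (𝓝 u) (𝓝 x) := by
      have := continuousAt_extChartAt_symm (I := 𝓡∂ 2) x
      rwa [ContinuousAt, extChartAt_to_inv, ← hu] at this
    filter_upwards [ht.eventually hmax'] with y hy
    rw [hψu, hmX]
    have : inner ℝ (ψ y) n - m * ‖ψ y‖ ^ 2 ≤ -ε := hy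
    linarith
  have hall := isLocalMax_inner_sub_norm_sq hcd2 hloc
  rw [hψu] at hall
  set w := n - (2 * m) • X x with hw
  have hnormal : ∀ i, inner ℝ (tangentVec X x i) w = 0 := fun i => by
    rw [tangentVec_eq_fderiv hx]; exact (hall _).1
  have htr := trace_inner_secondDeriv hX hs x hnormal
  have hsymm : IsSymmSndFDerivAt ℝ ψ u := hcd2.isSymmSndFDerivAt (by simp)
  have hdet := firstForm_det_pos hX x
  have h11 := firstForm_self_pos hX x 1
  set e : Fin 2 → E2 := fun i => EuclideanSpace.single i 1 with he
  -- With this `t` the images of `e 0 - t • e 1` and `e 1` are orthogonal, so the two Hessian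
  -- inequalities add up to a trace.
  set t := firstForm X x 0 1 / firstForm X x 1 1 with ht
  have hH1 := (hall (e 1)).2
  have hH0 := (hall (e 0 - t • e 1)).2
  have et : ∀ i, fderiv ℝ ψ u (e i) = tangentVec X x i := fun i => (tangentVec_eq_fderiv hx i).symm
  have es : ∀ i j, fderiv ℝ (fderiv ℝ ψ) u (e i) (e j) = secondDeriv X x i j :=
    fun i j => (secondDeriv_eq_fderiv hX.1 hx i j).symm
  have es10 : secondDeriv X x 1 0 = secondDeriv X x 0 1 := by
    rw [← es, ← es]; exact hsymm (e 1) (e 0)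
  rw [← real_inner_self_eq_norm_sq] at hH0 hH1
  simp only [map_sub, map_smul, sub_apply, smul_apply, et,
    es, es10, inner_sub_left, inner_sub_right, inner_smul_left, inner_smul_right, conj_trivial]
    at hH0 hH1
  have f00 : inner ℝ (tangentVec X x 0) (tangentVec X x 0) = firstForm X x 0 0 := rfl
  have f11 : inner ℝ (tangentVec X x 1) (tangentVec X x 1) = firstForm X x 1 1 := rfl
  have f01 : inner ℝ (tangentVec X x 0) (tangentVec X x 1) = firstForm X x 0 1 := rfl
  have f10 : inner ℝ (tangentVec X x 1) (tangentVec X x 0) = firstForm X x 0 1 :=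
    real_inner_comm _ _
  rw [f00, f01, f10, f11] at hH0
  rw [f11] at hH1
  have hwX : inner ℝ w (X x) = - inner ℝ (X x) n - 2 * ε := by
    rw [hw, inner_sub_left, inner_smul_left, real_inner_self_eq_norm_sq, real_inner_comm]
    simp only [conj_trivial]
    linarith
  -- By stationarity the trace of `⟨X_ij, w⟩` is then `4m + 4ε / |X|²`, while the maximum allows at
  -- most `4m`.
  have hkey : inner ℝ w (X x) / ‖X x‖ ^ 2 = - m - ε / ‖X x‖ ^ 2 := by
    rw [hwX, hm]; field_simp; ring
  rw [hkey] at htr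
  have hδ : 0 < ε / ‖X x‖ ^ 2 := div_pos hε (hpos x)
  generalize ε / ‖X x‖ ^ 2 = δ at htr hδ
  have htg : t * firstForm X x 1 1 = firstForm X x 0 1 := div_mul_cancel₀ _ h11.ne'
  generalize firstForm X x 0 0 = g00 at *
  generalize firstForm X x 0 1 = g01 at *
  generalize firstForm X x 1 1 = g11 at *
  clear_value t
  subst htg
  have hd : 0 < g00 - t ^ 2 * g11 := by
    have : 0 < g11 * (g00 - t ^ 2 * g11) := by linarith
    exact (pos_iff_pos_of_mul_pos this).1 h11
  -- Each inequality is weighted by the squared length of the other direction; their sum is the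
  -- trace times the determinant.
  have k0 := mul_le_mul_of_nonneg_left hH0 h11.le
  have k1 := mul_le_mul_of_nonneg_left hH1 hd.le
  have k2 : 0 < (g00 * g11 - (t * g11) ^ 2) * (4 * δ) := by positivity
  linarith

/-- A function `(⟨p, n⟩ + ε) / |p|²` with `ε > 0` is bounded on a compact `-4`-stationary surface
by its bounds on the boundary. -/
theorem le_of_boundary_le (hX : IsCompactStationarySurface (-4) X) (n : E3) {ε C : ℝ} (hε : 0 < ε)
    (hb : ∀ x ∈ (𝓡∂ 2).boundary M, (inner ℝ (X x) n + ε) / ‖X x‖ ^ 2 ≤ C) (x : M) :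
    (inner ℝ (X x) n + ε) / ‖X x‖ ^ 2 ≤ C := by
  have := hX.compact
  have hXc : Continuous X := hX.immersion.1.continuous
  have hc : Continuous fun y => (inner ℝ (X y) n + ε) / ‖X y‖ ^ 2 :=
    ((hXc.inner continuous_const).add continuous_const).div (hXc.norm.pow 2)
      fun y => pow_ne_zero 2 (norm_ne_zero_iff.2 (hX.stationary.1 y))
  obtain ⟨z, -, hz⟩ := isCompact_univ.exists_isMaxOn ⟨x, mem_univ x⟩ hc.continuousOn
  refine (hz (mem_univ x)).trans (hb z ?_)
  refine (ModelWithCorners.isInteriorPoint_or_isBoundaryPoint z).resolve_left fun hi => ?_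
  exact not_isLocalMax_of_interior hX.immersion hX.stationary hi n hε
    (hz.isLocalMax univ_mem)

end Local

/-! ### Confinement of the surface to the disc. -/

section Planar

variable {M : Type*} [TopologicalSpace M] [ChartedSpace (EuclideanHalfSpace 2) M] {X : M → E3}
  {P : Submodule ℝ E3} {c : E3} {r : ℝ}

theorem inner_nonpos_of_spans (hX : IsCompactStationarySurface (-4) X)
    (hs : Spans X (circleIn P c r)) {n : E3} (hn : ∀ p ∈ P, inner ℝ p n = 0) (hr : r < ‖c‖)
    (x : M) : inner ℝ (X x) n ≤ 0 := by
  by_contra! hpos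
  have hX0 : 0 < ‖X x‖ ^ 2 := pow_pos (norm_pos_iff.2 (hX.stationary.1 x)) 2
  set d := ‖c‖ - r with hd
  have hd0 : 0 < d := sub_pos.2 hr
  -- The boundary stays at distance at least `d` from the origin, so its bound `ε / d ^ 2` equals
  -- the value at `x` without the `ε` term, which the value with it exceeds.
  set ε := d ^ 2 * (inner ℝ (X x) n / ‖X x‖ ^ 2) with hε
  have hε0 : 0 < ε := by positivity
  have h := le_of_boundary_le hX n (C := ε / d ^ 2) hε0 ?_ x
  · have h1 : ε / d ^ 2 = inner ℝ (X x) n / ‖X x‖ ^ 2 := by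
      rw [hε]; field_simp
    rw [h1, add_div] at h
    have : 0 < ε / ‖X x‖ ^ 2 := by positivity
    linarith
  · intro y hy
    have hy' : X y ∈ circleIn P c r := hs ▸ mem_image_of_mem X hy
    rw [hn _ hy'.1, zero_add]
    have hdy : d ≤ ‖X y‖ := by
      have h1 := norm_sub_norm_le c (X y)
      have h2 : ‖c - X y‖ = r := by rw [← dist_eq_norm, dist_comm]; exact hy'.2
      linarith
    gcongr

theorem mem_discIn_of_spans (hX : IsCompactStationarySurface (-4) X)
    (hs : Spans X (circleIn P c r)) (hr0 : 0 < r) (hr : r < ‖c‖) (x : M) : X x ∈ discIn P c r := by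
  have hpos : ∀ y, 0 < ‖X y‖ ^ 2 := fun y => pow_pos (norm_pos_iff.2 (hX.stationary.1 y)) 2
  refine ⟨?_, ?_⟩
  · rw [← Submodule.orthogonal_orthogonal P, Submodule.mem_orthogonal]
    intro n hn
    rw [Submodule.mem_orthogonal] at hn
    have h1 := inner_nonpos_of_spans hX hs hn hr x
    have h2 := inner_nonpos_of_spans hX hs (n := -n)
      (fun p hp => by rw [inner_neg_right, hn p hp, neg_zero]) hr x
    rw [inner_neg_right] at h2
    rw [real_inner_comm]
    linarith
  · have hexp : ∀ p : E3, dist p c ^ 2 = ‖p‖ ^ 2 - 2 * inner ℝ p c + ‖c‖ ^ 2 := fun p => by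
      rw [dist_eq_norm, norm_sub_sq_real]
    have hin : ∀ p : E3, inner ℝ p ((-2 : ℝ) • c) = -2 * inner ℝ p c := fun p =>
      inner_smul_right _ _ _
    have hε : 0 < ‖c‖ ^ 2 - r ^ 2 := by
      have : r ^ 2 < ‖c‖ ^ 2 := by gcongr
      linarith
    -- Here the function equals `(|p - c|² - r²) / |p|² - 1`, so it is at most `-1` exactly in the
    -- ball.
    have h := le_of_boundary_le hX ((-2 : ℝ) • c) (C := -1) hε ?_ x
    · rw [div_le_iff₀ (hpos x), hin] at h
      refine le_of_sq_le_sq ?_ hr0.le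
      rw [hexp]
      linarith
    · intro y hy
      have hy' : X y ∈ circleIn P c r := hs ▸ mem_image_of_mem X hy
      have h1 := hexp (X y)
      rw [hy'.2] at h1
      rw [div_le_iff₀ (hpos y), hin]
      linarith

theorem lt_norm_of_zero_notMem (h0 : (0 : E3) ∉ discIn P c r) : r < ‖c‖ := by
  by_contra! h
  exact h0 ⟨P.zero_mem, by simpa using h⟩

end Planar

/-! ### Local homeomorphisms onto convex sets -/

section Covering

variable {M G : Type*} [TopologicalSpace M] [NormedAddCommGroup G] [NormedSpace ℝ G] {D : Set G}

/-- A connected covering of a convex set is trivial: the contraction of the base lifts. -/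
theorem IsCoveringMap.injective_of_convex [PreconnectedSpace M] (hD : Convex ℝ D) {f : M → D}
    (hf : IsCoveringMap f) : Function.Injective f := by
  intro a b hab
  have hmem : ∀ s : unitInterval × M,
      (1 - (s.1 : ℝ)) • (f s.2 : G) + (s.1 : ℝ) • (f a : G) ∈ D := fun s =>
    hD (f s.2).2 (f a).2 (sub_nonneg.2 s.1.2.2) s.1.2.1 (by ring)
  have hfc : Continuous f := hf.continuous
  let H : C(unitInterval × M, D) :=
    ⟨fun s => ⟨_, hmem s⟩, Continuous.subtype_mk (by fun_prop) _⟩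
  have H0 : ∀ x : M, H (0, x) = f (ContinuousMap.id M x) := fun x => Subtype.ext (by simp [H])
  have H1 : ∀ x : M, H (1, x) = f a := fun x => Subtype.ext (by simp [H])
  have hlift := hf.liftHomotopy_lifts H (ContinuousMap.id M) H0
  have hzero := hf.liftHomotopy_zero H (ContinuousMap.id M) H0
  set K := hf.liftHomotopy H (ContinuousMap.id M) H0
  -- At time `1` the lift stays in a single fibre, which is discrete, so it is constant on the
  -- connected space `M`.
  have hend : K (1, a) = K (1, b) := by
    refine hf.const_of_comp (g := fun x => K (1, x)) (by fun_prop) (fun x y => ?_) a b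
    have h1 := congrFun hlift (1, x)
    have h2 := congrFun hlift (1, y)
    simp only [Function.comp_apply] at h1 h2
    rw [h1, h2, H1, H1]
  -- Since `f a = f b`, both paths lift the same segment; they meet at time `1`, hence also at time
  -- `0`, where they start at `a` and `b`.
  have hpath : (fun t : unitInterval => K (t, a)) = fun t => K (t, b) := by
    refine hf.eq_of_comp_eq (by fun_prop) (by fun_prop) (funext fun t => ?_) 1 hend
    have h1 := congrFun hlift (t, a)
    have h2 := congrFun hlift (t, b)
    simp only [Function.comp_apply] at h1 h2 ⊢
    rw [h1, h2]
    exact Subtype.ext (by simp [H, hab])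
  have := congrFun hpath 0
  simpa [hzero] using this

/-- A locally injective map into a convex set, open near the points of a dense set that contains
the preimage of the interior, is open. -/
theorem image_mem_nhdsWithin_of_locally_injective [T2Space M] [LocallyCompactSpace M]
    (hD : Convex ℝ D) (hDi : (interior D).Nonempty) {f : M → G} (hf : Continuous f) {U : Set M}
    (hU : Dense U) (hopen : ∀ x ∈ U, 𝓝 (f x) ≤ map f (𝓝 x))
    (hint : ∀ x, f x ∈ interior D ↔ x ∈ U) {x : M} (hinj : ∃ V ∈ 𝓝 x, InjOn f V)
    {N : Set M} (hN : N ∈ 𝓝 x) : f '' N ∈ 𝓝[D] (f x) := by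
  obtain ⟨V, hV, hVinj⟩ := hinj
  obtain ⟨K, hK, hKs, hKc⟩ := local_compact_nhds (inter_mem hV hN)
  have hKinj : InjOn f K := hVinj.mono (hKs.trans inter_subset_left)
  have hxK : x ∈ K := mem_of_mem_nhds hK
  have hxi : x ∈ interior K := mem_interior_iff_mem_nhds.2 hK
  have hKcl : IsClosed K := hKc.isClosed
  have hfr : IsClosed (f '' frontier K) :=
    ((hKc.of_isClosed_subset isClosed_frontier hKcl.frontier_subset).image hf).isClosed
  have hxfr : f x ∉ f '' frontier K := by
    rintro ⟨y, hy, hyx⟩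
    have := hKinj (hKcl.frontier_subset hy) hxK hyx
    rw [this] at hy
    exact hy.2 hxi
  obtain ⟨ρ, hρ, hball⟩ := Metric.isOpen_iff.1 hfr.isOpen_compl _ hxfr
  set B := Metric.ball (f x) ρ with hB
  have hfK : IsClosed (f '' K) := (hKc.image hf).isClosed
  -- The ball `B` misses the image of the frontier of `K`, so `f '' K` is both open and closed
  -- relative to the convex set `B ∩ interior D`, and therefore contains it.
  have hu : IsOpen (B ∩ interior D ∩ f '' K) := by
    rw [isOpen_iff_mem_nhds]
    rintro _ ⟨hy, k, hk, rfl⟩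
    refine inter_mem ((Metric.isOpen_ball.inter isOpen_interior).mem_nhds hy) ?_
    have hki : k ∈ interior K := by
      by_contra h
      exact hball hy.1 (mem_image_of_mem f ⟨subset_closure hk, h⟩)
    exact hopen k ((hint k).1 hy.2) (image_mem_map (mem_interior_iff_mem_nhds.1 hki))
  have hne : (B ∩ interior D ∩ (B ∩ interior D ∩ f '' K)).Nonempty := by
    obtain ⟨z, hz, hzU⟩ := hU.inter_open_nonempty (interior K ∩ f ⁻¹' B)
      (isOpen_interior.inter (Metric.isOpen_ball.preimage hf)) ⟨x, hxi, Metric.mem_ball_self hρ⟩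
    have h1 : f z ∈ B ∩ interior D := ⟨hz.2, (hint z).2 hzU⟩
    exact ⟨f z, h1, h1, mem_image_of_mem f (interior_subset hz.1)⟩
  have hsub : B ∩ interior D ⊆ B ∩ interior D ∩ f '' K := by
    refine ((convex_ball _ _).inter hD.interior).isPreconnected.subset_of_closure_inter_subset hu
      hne ?_
    rintro y ⟨hy, hyC⟩
    exact ⟨hyC, closure_minimal inter_subset_right hfK hy⟩
  -- Boundary points of `D` are reached by closure: a convex set with nonempty interior lies in the
  -- closure of that interior.
  have hBD : B ∩ D ⊆ f '' K := by
    have h1 : D ⊆ closure (interior D) := by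
      rw [hD.closure_interior_eq_closure_of_nonempty_interior hDi]; exact subset_closure
    calc B ∩ D ⊆ B ∩ closure (interior D) := inter_subset_inter_right _ h1
      _ ⊆ closure (B ∩ interior D) := Metric.isOpen_ball.inter_closure
      _ ⊆ f '' K := closure_minimal (hsub.trans inter_subset_right) hfK
  refine mem_of_superset (inter_mem (mem_nhdsWithin_of_mem_nhds (Metric.ball_mem_nhds _ hρ))
    self_mem_nhdsWithin) (hBD.trans (image_mono (hKs.trans inter_subset_right)))

/-- A compact connected space that is mapped to a convex set in a locally injective way, and openly
over the interior, is mapped bijectively. -/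
theorem bijOn_convex_of_locally_injective [T2Space M] [CompactSpace M] [ConnectedSpace M]
    (hD : Convex ℝ D) (hDi : (interior D).Nonempty) {f : M → G} (hf : Continuous f)
    (hfD : ∀ x, f x ∈ D) {U : Set M} (hU : Dense U) (hopen : ∀ x ∈ U, 𝓝 (f x) ≤ map f (𝓝 x))
    (hint : ∀ x, f x ∉ interior D ∨ x ∈ U) (hinj : ∀ x, ∃ V ∈ 𝓝 x, InjOn f V) :
    Function.Injective f ∧ range f = D := by
  have hint' : ∀ x, f x ∈ interior D ↔ x ∈ U := fun x => by
    refine ⟨fun h => (hint x).resolve_left (not_not.2 h), fun h => ?_⟩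
    rw [mem_interior_iff_mem_nhds]
    exact hopen x h (mem_map.2 (univ_mem' hfD))
  set g : M → D := codRestrict f D hfD with hg
  have hgc : Continuous g := hf.codRestrict hfD
  have hgo : IsOpenMap g := by
    rw [isOpenMap_iff_nhds_le]
    intro x s hs
    have h1 := image_mem_nhdsWithin_of_locally_injective hD hDi hf hU hopen hint' (hinj x)
      (mem_map.1 hs)
    refine mem_of_superset (preimage_coe_mem_nhds_subtype.2 h1) ?_
    rintro y ⟨z, hz, hzy⟩
    have : g z = y := Subtype.ext hzy
    exact this ▸ hz
  have hlh : IsLocalHomeomorph g := by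
    rw [isLocalHomeomorph_iff_isOpenEmbedding_restrict]
    intro x
    obtain ⟨V, hV, hVinj⟩ := hinj x
    refine ⟨interior V, interior_mem_nhds.2 hV, .of_continuous_injective_isOpenMap
      (hgc.comp continuous_subtype_val) ?_ (hgo.domRestrict isOpen_interior)⟩
    intro a b hab
    exact Subtype.ext (hVinj (interior_subset a.2) (interior_subset b.2) (congrArg Subtype.val hab))
  -- Compactness of `M` enters here.
  have hcov : IsCoveringMap g := isLocalHomeomorph_iff_isCoveringMap.1 hlh
  refine ⟨fun a b hab => IsCoveringMap.injective_of_convex hD hcov (Subtype.ext hab), ?_⟩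
  have : PreconnectedSpace D := Subtype.preconnectedSpace hD.isPreconnected
  have huniv : range g = univ :=
    IsClopen.eq_univ ⟨(isCompact_range hgc).isClosed, hgo.isOpen_range⟩ (range_nonempty g)
  refine Subset.antisymm (range_subset_iff.2 hfD) fun y hy => ?_
  obtain ⟨x, hx⟩ := huniv.symm ▸ mem_univ (⟨y, hy⟩ : D)
  exact ⟨x, congrArg Subtype.val hx⟩

end Covering

/-! ### Immersions of surfaces with boundary -/

section Immersion

variable {E : Type*} [NormedAddCommGroup E] [NormedSpace ℝ E] {H : Type*} [TopologicalSpace H]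
  {I : ModelWithCorners ℝ E H} {M : Type*} [TopologicalSpace M] [ChartedSpace H M]
  {G : Type*} [NormedAddCommGroup G] [NormedSpace ℝ G]

/-- In a chart this is the density of the interior of the model range in that range. -/
theorem dense_interior [IsManifold I 1 M] : Dense (I.interior M) := by
  intro x
  rw [mem_closure_iff_nhds]
  intro V hV
  set u := extChartAt I x x with hu
  have h1 : (extChartAt I x).symm ⁻¹' V ∩ (extChartAt I x).target ∈ 𝓝[range I] u := by
    refine inter_mem ?_ (extChartAt_target_mem_nhdsWithin x)
    apply mem_nhdsWithin_of_mem_nhds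
    refine (continuousAt_extChartAt_symm x).preimage_mem_nhds ?_
    rwa [extChartAt_to_inv]
  obtain ⟨O, hO, huO, hOs⟩ := mem_nhdsWithin.1 h1
  obtain ⟨w, hwO, hw⟩ := mem_closure_iff.1
    (I.range_subset_closure_interior (mem_range_self (chartAt H x x))) O hO huO
  have hwt := hOs ⟨hwO, interior_subset hw⟩
  refine ⟨(extChartAt I x).symm w, hwt.1, ?_⟩
  have hsrc : (extChartAt I x).symm w ∈ (chartAt H x).source := by
    rw [← extChartAt_source I]; exact (extChartAt I x).map_target hwt.2
  refine (ModelWithCorners.isInteriorPoint_iff_of_mem_atlas (n := 1) one_ne_zero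
    (chart_mem_atlas H x) hsrc).2 ?_
  have hww : (chartAt H x).extend I ((extChartAt I x).symm w) = w :=
    (extChartAt I x).right_inv hwt.2
  rw [hww, OpenPartialHomeomorph.extend_target, interior_inter]
  refine ⟨?_, hw⟩
  have hopen : IsOpen (I.symm ⁻¹' (chartAt H x).target) :=
    (chartAt H x).open_target.preimage I.continuous_symm
  rw [hopen.interior_eq]
  have := hwt.2
  rw [extChartAt_target] at this
  exact this.1

/-- At a boundary point the chart domain is only one-sided, but a small ball cut by the model range
is convex, so the mean value inequality against the antilipschitz derivative at `u` gives
injectivity. -/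
theorem exists_injOn_of_injective_mfderiv [FiniteDimensional ℝ E] {f : M → G}
    (hf : ContMDiff I 𝓘(ℝ, G) 1 f) {x : M} (hinj : Function.Injective (mfderiv I 𝓘(ℝ, G) f x)) :
    ∃ V ∈ 𝓝 x, InjOn f V := by
  set u := extChartAt I x x with hu
  set ψ := f ∘ (extChartAt I x).symm with hψ
  have hur : u ∈ range I := mem_range_self _
  have hcd : ContDiffWithinAt ℝ (0 + 1) ψ (range I) u := by
    rw [zero_add]; exact (contMDiffAt_iff.1 (hf x)).2
  have hmf : mfderiv I 𝓘(ℝ, G) f x = fderivWithin ℝ ψ (range I) u := by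
    rw [((hf x).mdifferentiableAt (by simp)).mfderiv]; rfl
  obtain ⟨s, hs, -, f', hf', hc⟩ := (contDiffWithinAt_succ_iff_hasFDerivWithinAt (by simp)).1 hcd
  rw [insert_eq_of_mem hur] at hs
  have hus : u ∈ s := mem_of_mem_nhdsWithin hur hs
  have hfu : f' u = fderivWithin ℝ ψ (range I) u :=
    (((hf' u hus).mono_of_mem_nhdsWithin hs).fderivWithin (I.uniqueDiffOn u hur)).symm
  rw [hmf, ← hfu] at hinj
  obtain ⟨K, hK, hanti⟩ := (f' u).toLinearMap.exists_antilipschitzWith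
    (LinearMap.ker_eq_bot.2 hinj)
  -- Half of the lower bound `K⁻¹` for the derivative at `u`: the error then absorbs at most half of
  -- `‖b - a‖`.
  set C : ℝ := (2 * K : ℝ)⁻¹ with hC
  have hC0 : 0 < C := by positivity
  have hnear : {y | ‖f' y - f' u‖ ≤ C} ∈ 𝓝[s] u := by
    have := hc.continuousWithinAt.tendsto
    filter_upwards [this (Metric.closedBall_mem_nhds _ hC0)] with y hy
    simpa [dist_eq_norm] using hy
  have hnear' : {y | ‖f' y - f' u‖ ≤ C} ∩ s ∈ 𝓝[range I] u :=
    inter_mem (nhdsWithin_le_of_mem hs hnear) hs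
  obtain ⟨δ, hδ, hball⟩ := Metric.mem_nhdsWithin_iff.1 hnear'
  set T := Metric.ball u δ ∩ range I with hT
  have hTconv : Convex ℝ T := (convex_ball u δ).inter I.convex_range
  have hψinj : InjOn ψ T := by
    intro a ha b hb hab
    have hmv := hTconv.norm_image_sub_le_of_norm_hasFDerivWithin_le' (f := ψ) (f' := f')
      (φ := f' u) (fun y hy => (hf' y (hball hy).2).mono (fun z hz => (hball hz).2))
      (fun y hy => (hball hy).1) ha hb
    rw [hab, sub_self, zero_sub, norm_neg] at hmv
    have hlow := hanti.le_mul_dist b a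
    rw [dist_eq_norm, dist_eq_norm, ← map_sub] at hlow
    have hlow' : ‖b - a‖ ≤ K * ‖f' u (b - a)‖ := hlow
    have hK0 : (0 : ℝ) < K := hK
    have : K * ‖f' u (b - a)‖ ≤ ‖b - a‖ / 2 := by
      calc K * ‖f' u (b - a)‖ ≤ K * (C * ‖b - a‖) := by gcongr
        _ = ‖b - a‖ / 2 := by rw [hC]; field_simp
    have h0 : ‖b - a‖ ≤ 0 := by linarith
    exact (sub_eq_zero.1 (norm_le_zero_iff.1 h0)).symm
  refine ⟨extChartAt I x ⁻¹' Metric.ball u δ ∩ (extChartAt I x).source,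
    inter_mem ((continuousAt_extChartAt x).preimage_mem_nhds (Metric.ball_mem_nhds _ hδ))
      (extChartAt_source_mem_nhds x), ?_⟩
  intro a ha b hb hab
  have hmem : ∀ y ∈ (extChartAt I x).source, extChartAt I x y ∈ range I := fun y hy =>
    extChartAt_target_subset_range x ((extChartAt I x).map_source hy)
  refine (extChartAt I x).injOn ha.2 hb.2
    (hψinj ⟨ha.1, hmem a ha.2⟩ ⟨hb.1, hmem b hb.2⟩ ?_)
  simp only [hψ, Function.comp_apply]
  rw [(extChartAt I x).left_inv ha.2, (extChartAt I x).left_inv hb.2, hab]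

theorem nhds_le_map_of_surjective_mfderiv [CompleteSpace E] [CompleteSpace G] {f : M → G}
    (hf : ContMDiff I 𝓘(ℝ, G) 1 f) {x : M} (hx : I.IsInteriorPoint x)
    (hsurj : Function.Surjective (mfderiv I 𝓘(ℝ, G) f x)) : 𝓝 (f x) ≤ map f (𝓝 x) := by
  set u := extChartAt I x x with hu
  set ψ := f ∘ (extChartAt I x).symm with hψ
  have hr : range I ∈ 𝓝 u := mem_interior_iff_mem_nhds.1 hx
  have hcd : ContDiffAt ℝ 1 ψ u :=
    ContDiffWithinAt.contDiffAt (contMDiffAt_iff.1 (hf x)).2 hr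
  have hmf : mfderiv I 𝓘(ℝ, G) f x = fderiv ℝ ψ u := by
    rw [((hf x).mdifferentiableAt (by simp)).mfderiv, ← fderivWithin_of_mem_nhds hr]; rfl
  rw [hmf] at hsurj
  have hmap := (hcd.hasStrictFDerivAt (by simp)).map_nhds_eq_of_surj
    (LinearMap.range_eq_top.2 hsurj)
  have hψu : ψ u = f x := congrArg f (extChartAt_to_inv (I := I) x)
  rw [hψu] at hmap
  rw [← hmap, hψ, ← Filter.map_map]
  refine Filter.map_mono ?_
  have := (continuousAt_extChartAt_symm (I := I) x).tendsto
  rwa [extChartAt_to_inv] at this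

end Immersion

/-! ### Complex coordinates on a plane -/

/-- A complex coordinate on the plane `P` in which the disc with centre `c` and radius `r` is the
unit disc. -/
structure PlaneCoord (P : Submodule ℝ E3) (c : E3) (r : ℝ) where
  /-- The parametrization of the plane. -/
  param : ℂ → E3
  /-- The coordinate, extended to the whole space. -/
  coord : E3 → ℂ
  contDiff_param : ContDiff ℝ ∞ param
  contDiff_coord : ContDiff ℝ ∞ coord
  param_mem : ∀ z, param z ∈ P
  param_coord : ∀ p ∈ P, param (coord p) = p
  coord_param : ∀ z, coord (param z) = z
  dist_param : ∀ z, dist (param z) c = r * ‖z‖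

theorem nonempty_planeCoord {P : Submodule ℝ E3} (hP : Module.finrank ℝ P = 2) {c : E3} (hc : c ∈ P)
    {r : ℝ} (hr : 0 < r) : Nonempty (PlaneCoord P c r) := by
  let e : ℂ ≃ₗᵢ[ℝ] P := Complex.orthonormalBasisOneI.equiv (stdOrthonormalBasis ℝ P)
    (finCongr hP.symm)
  refine ⟨⟨fun z => c + r • (e z : E3),
    fun p => r⁻¹ • e.symm (P.orthogonalProjectionOnto (p - c)), ?_, ?_, fun z => ?_, fun p hp => ?_,
    fun z => ?_, fun z => ?_⟩⟩
  · have h : ContDiff ℝ ∞ fun z => (e z : E3) :=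
      P.subtypeL.contDiff.comp e.toContinuousLinearEquiv.contDiff
    fun_prop
  · have h : ContDiff ℝ ∞ fun p : E3 => e.symm (P.orthogonalProjectionOnto (p - c)) :=
      e.symm.toContinuousLinearEquiv.contDiff.comp
        (P.orthogonalProjectionOnto.contDiff.comp (contDiff_id.sub contDiff_const))
    fun_prop
  · exact P.add_mem hc (P.smul_mem _ (e z).2)
  · have h := Submodule.orthogonalProjectionOnto_mem_subspace_eq_self
      (⟨p - c, P.sub_mem hp hc⟩ : P)
    simp only at h
    simp only [map_smul, e.apply_symm_apply, h, Submodule.coe_smul, smul_smul,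
      mul_inv_cancel₀ hr.ne', one_smul, add_sub_cancel]
  · simp only [add_sub_cancel_left, map_smul, Submodule.orthogonalProjectionOnto_mem_subspace_eq_self,
      e.symm_apply_apply, smul_smul, inv_mul_cancel₀ hr.ne', one_smul]
  · rw [dist_eq_norm, add_sub_cancel_left, norm_smul, ← Submodule.coe_norm, e.norm_map,
      Real.norm_of_nonneg hr.le]

theorem injective_of_hasFDerivAt_comp {E F : Type*} [NormedAddCommGroup E] [NormedSpace ℝ E]
    [NormedAddCommGroup F] [NormedSpace ℝ F] {f : E → F} {g : F → E} {f' : E →L[ℝ] F} {x : E}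
    (hf : HasFDerivAt f f' x) (hg : DifferentiableAt ℝ g (f x)) (h : ∀ᶠ y in 𝓝 x, g (f y) = y) :
    Function.Injective f' := by
  have h1 := hg.hasFDerivAt.comp x hf
  have h2 : HasFDerivAt (g ∘ f) (ContinuousLinearMap.id ℝ E) x :=
    (hasFDerivAt_id x).congr_of_eventuallyEq h
  have h3 := h1.unique h2
  refine Function.LeftInverse.injective (g := fderiv ℝ g (f x)) fun v => ?_
  exact congrArg (fun A : E →L[ℝ] E => A v) h3

namespace PlaneCoord

variable {P : Submodule ℝ E3} {c : E3} {r : ℝ} (C : PlaneCoord P c r)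

theorem dist_eq {p : E3} (hp : p ∈ P) : dist p c = r * ‖C.coord p‖ := by
  rw [← C.dist_param, C.param_coord p hp]

theorem norm_coord_le_one (hr : 0 < r) {p : E3} (hp : p ∈ discIn P c r) : ‖C.coord p‖ ≤ 1 := by
  have := hp.2
  rw [C.dist_eq hp.1] at this
  exact le_of_mul_le_mul_left (by linarith) hr

theorem param_mem_discIn (hr : 0 < r) {z : ℂ} (hz : ‖z‖ ≤ 1) : C.param z ∈ discIn P c r := by
  refine ⟨C.param_mem z, ?_⟩
  rw [C.dist_param]
  exact mul_le_of_le_one_right hr.le hz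

theorem mem_circleIn_iff (hr : 0 < r) {p : E3} (hp : p ∈ P) :
    p ∈ circleIn P c r ↔ ‖C.coord p‖ = 1 := by
  refine ⟨fun h => ?_, fun h => ⟨hp, by rw [C.dist_eq hp, h, mul_one]⟩⟩
  have := h.2
  rw [C.dist_eq hp] at this
  exact mul_left_cancel₀ hr.ne' (by linarith)

end PlaneCoord

/-! ### Uniqueness -/

theorem surjective_of_injective_to_complex (A : E2 →L[ℝ] ℂ) (hA : Function.Injective A) :
    Function.Surjective A :=
  (LinearMap.injective_iff_surjective_of_finrank_eq_finrank (f := A.toLinearMap) (by simp)).1 hA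

section Uniqueness

variable {M : Type*} [TopologicalSpace M] [ChartedSpace (EuclideanHalfSpace 2) M] {X : M → E3}
  {P : Submodule ℝ E3} {c : E3} {r : ℝ}

/-- A compact surface immersed in a planar disc and spanning its boundary circle is the disc. -/
theorem injective_and_range_eq_discIn (hP : Module.finrank ℝ P = 2) (hc : c ∈ P) (hr : 0 < r)
    (hman : IsManifold (𝓡∂ 2) ∞ M) [T2Space M] [CompactSpace M] [ConnectedSpace M]
    (himm : IsSmoothImmersion X) (hs : Spans X (circleIn P c r))
    (hdisc : ∀ x, X x ∈ discIn P c r) :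
    Function.Injective X ∧ range X = discIn P c r := by
  obtain ⟨C⟩ := nonempty_planeCoord hP hc hr
  have : IsManifold (𝓡∂ 2) 1 M := IsManifold.of_le (n := ∞) (by norm_cast)
  have : LocallyCompactSpace M := Manifold.locallyCompact_of_finiteDimensional (𝓡∂ 2)
  -- Read in the plane, the immersion has equal source and target dimensions, so its derivative is
  -- also surjective.
  set f : M → ℂ := C.coord ∘ X with hf
  have hXf : X = C.param ∘ f := funext fun x => (C.param_coord _ (hdisc x).1).symm
  have hfs : ContMDiff (𝓡∂ 2) 𝓘(ℝ, ℂ) 1 f :=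
    (C.contDiff_coord.contMDiff.comp himm.1).of_le (by norm_cast)
  have hinj : ∀ x, Function.Injective (mfderiv (𝓡∂ 2) 𝓘(ℝ, ℂ) f x) := fun x => by
    have h1 := himm.2 x
    rw [hXf, mfderiv_comp x ((C.contDiff_param.contMDiff (f x)).mdifferentiableAt (by simp))
      ((hfs x).mdifferentiableAt (by simp))] at h1
    exact Function.Injective.of_comp h1
  have hsurj : ∀ x, Function.Surjective (mfderiv (𝓡∂ 2) 𝓘(ℝ, ℂ) f x) := fun x =>
    surjective_of_injective_to_complex _ (hinj x)
  have hDi : interior (Metric.closedBall (0 : ℂ) 1) = Metric.ball 0 1 :=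
    interior_closedBall _ one_ne_zero
  have hmain := bijOn_convex_of_locally_injective (convex_closedBall (0 : ℂ) 1)
    (by rw [hDi]; exact ⟨0, Metric.mem_ball_self one_pos⟩) hfs.continuous
    (fun x => mem_closedBall_zero_iff.2 (C.norm_coord_le_one hr (hdisc x)))
    (dense_interior (I := 𝓡∂ 2)) (fun x hx => nhds_le_map_of_surjective_mfderiv hfs hx (hsurj x))
    (fun x => ?_) (fun x => exists_injOn_of_injective_mfderiv hfs (hinj x))
  · refine ⟨hXf ▸ (Function.LeftInverse.injective C.coord_param).comp hmain.1, ?_⟩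
    refine Subset.antisymm (range_subset_iff.2 hdisc) fun p hp => ?_
    obtain ⟨x, hx⟩ := hmain.2.symm ▸ mem_closedBall_zero_iff.2 (C.norm_coord_le_one hr hp)
    refine ⟨x, ?_⟩
    rw [hXf, Function.comp_apply, hx, C.param_coord p hp.1]
  · rcases ModelWithCorners.isInteriorPoint_or_isBoundaryPoint (I := 𝓡∂ 2) x with hx | hx
    · exact .inr hx
    · left
      have h1 : X x ∈ circleIn P c r := hs ▸ mem_image_of_mem X hx
      have h2 := (C.mem_circleIn_iff hr h1.1).1 h1
      rw [hDi, mem_ball_zero_iff]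
      exact h2.not_lt

end Uniqueness

/-! ### Planar surfaces are stationary -/

/-- Pairing `f` with a vector orthogonal to `P` gives zero on `s`, and unique differentiability
passes this to the derivative. Without differentiability the derivative is `0` by convention. -/
theorem fderivWithin_mem_submodule {E F : Type*} [NormedAddCommGroup E] [NormedSpace ℝ E]
    [NormedAddCommGroup F] [InnerProductSpace ℝ F] {P : Submodule ℝ F} [P.HasOrthogonalProjection]
    {f : E → F} {s : Set E} (hf : ∀ y ∈ s, f y ∈ P) (hs : UniqueDiffOn ℝ s) {x : E} (hx : x ∈ s)
    (v : E) : fderivWithin ℝ f s x v ∈ P := by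
  by_cases hd : DifferentiableWithinAt ℝ f s x
  · rw [← Submodule.orthogonal_orthogonal P, Submodule.mem_orthogonal]
    intro n hn
    have h1 := (innerSL ℝ n).hasFDerivAt.comp_hasFDerivWithinAt x hd.hasFDerivWithinAt
    have h2 : HasFDerivWithinAt (innerSL ℝ n ∘ f) (0 : E →L[ℝ] ℝ) s x :=
      (hasFDerivWithinAt_const (0 : ℝ) x s).congr
        (fun y hy => (Submodule.mem_orthogonal' _ _).1 hn _ (hf y hy))
        ((Submodule.mem_orthogonal' _ _).1 hn _ (hf x hx))
    have h3 := (hs x hx).eq h1 h2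
    exact congrArg (fun A : E →L[ℝ] ℝ => A v) h3
  · rw [fderivWithin_zero_of_not_differentiableWithinAt hd]
    exact P.zero_mem

section Planar

variable {M : Type*} [TopologicalSpace M] [ChartedSpace (EuclideanHalfSpace 2) M] {X : M → E3}
  {P : Submodule ℝ E3}

theorem partialDeriv_mem (hX : ∀ x, X x ∈ P) (x : M) (i : Fin 2) {u : E2}
    (hu : u ∈ range (𝓡∂ 2)) : partialDeriv X x i u ∈ P :=
  fderivWithin_mem_submodule (fun _ _ => hX _) (𝓡∂ 2).uniqueDiffOn hu _

theorem tangentVec_mem (hX : ∀ x, X x ∈ P) (x : M) (i : Fin 2) : tangentVec X x i ∈ P :=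
  partialDeriv_mem hX x i (mem_range_self _)

theorem secondDeriv_mem (hX : ∀ x, X x ∈ P) (x : M) (i j : Fin 2) : secondDeriv X x i j ∈ P :=
  fderivWithin_mem_submodule (fun _ hu => partialDeriv_mem hX x j hu) (𝓡∂ 2).uniqueDiffOn
    (mem_range_self _) _

/-- Surfaces immersed in a vector plane are stationary. -/
theorem isStationary_of_mem_plane (hP : Module.finrank ℝ P = 2) (himm : IsSmoothImmersion X)
    (hX : ∀ x, X x ∈ P) (h0 : ∀ x, X x ≠ 0) (α : ℝ) : IsStationary α X := by
  refine ⟨h0, fun x ν hν => ?_⟩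
  have hspan : Submodule.span ℝ (range (tangentVec X x)) = P := by
    refine Submodule.eq_of_le_of_finrank_eq
      (Submodule.span_le.2 (range_subset_iff.2 (tangentVec_mem hX x))) ?_
    rw [finrank_span_eq_card (linearIndependent_tangentVec himm x), hP, Fintype.card_fin]
  -- Second derivatives and position vectors lie in `P`, so orthogonality of `ν` to `P` annihilates
  -- both sides.
  have hperp : ∀ p ∈ P, inner ℝ p ν = 0 := by
    intro p hp
    rw [← hspan] at hp
    induction hp using Submodule.span_induction with
    | mem y hy => obtain ⟨i, rfl⟩ := hy; exact hν.2 i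
    | zero => exact inner_zero_left _
    | add y z _ _ hy hz => rw [inner_add_left, hy, hz, add_zero]
    | smul a y _ hy => rw [inner_smul_left, hy, mul_zero]
  simp only [meanCurvature, secondForm, hperp _ (secondDeriv_mem hX x _ _),
    real_inner_comm (X x) ν, hperp _ (hX x)]
  simp

end Planar

/-! ### The closed disc as a manifold with boundary -/

/-- The isometry between `ℂ` and the parameter plane, taking the real part to the coordinate that
defines the half-plane. -/
def planeIso : ℂ ≃ₗᵢ[ℝ] E2 := Complex.orthonormalBasisOneI.repr

theorem planeIso_apply_zero (w : ℂ) : planeIso w 0 = w.re := by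
  simp [planeIso]

theorem re_planeIso_symm (u : E2) : (planeIso.symm u).re = u 0 := by
  rw [← planeIso_apply_zero, planeIso.apply_symm_apply]

/-- The Cayley transform of the unit disc onto the right half-plane that has its pole at `b`, where
`b = ± 1`. -/
def cayley (b z : ℂ) : ℂ := (1 + b * z) / (1 - b * z)

/-- The inverse of the Cayley transform. -/
def cayleyInv (b w : ℂ) : ℂ := b * ((w - 1) / (w + 1))

section Cayley

variable {b : ℂ}

theorem add_one_ne_zero_of_re_nonneg {w : ℂ} (hw : 0 ≤ w.re) : w + 1 ≠ 0 := fun h => by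
  have := congrArg Complex.re h
  simp at this
  linarith

theorem cayleyInv_cayley (hb : b * b = 1) {z : ℂ} (hz : 1 - b * z ≠ 0) :
    cayleyInv b (cayley b z) = z := by
  have h1 : cayley b z + 1 = 2 / (1 - b * z) := by rw [cayley]; field_simp; ring
  have h2 : cayley b z - 1 = 2 * (b * z) / (1 - b * z) := by rw [cayley]; field_simp; ring
  rw [cayleyInv, h1, h2, div_div_div_cancel_right₀ hz, mul_div_cancel_left₀ _ two_ne_zero,
    ← mul_assoc, hb, one_mul]

theorem one_sub_mul_cayleyInv (hb : b * b = 1) {w : ℂ} (hw : w + 1 ≠ 0) :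
    1 - b * cayleyInv b w = 2 / (w + 1) := by
  rw [cayleyInv, ← mul_assoc, hb, one_mul]; field_simp; ring

theorem one_sub_mul_cayleyInv_ne_zero (hb : b * b = 1) {w : ℂ} (hw : w + 1 ≠ 0) :
    1 - b * cayleyInv b w ≠ 0 := by
  rw [one_sub_mul_cayleyInv hb hw]
  exact div_ne_zero two_ne_zero hw

theorem cayley_cayleyInv (hb : b * b = 1) {w : ℂ} (hw : w + 1 ≠ 0) :
    cayley b (cayleyInv b w) = w := by
  have h : 1 + b * cayleyInv b w = 2 * w / (w + 1) := by
    rw [cayleyInv, ← mul_assoc, hb, one_mul]; field_simp; ring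
  rw [cayley, one_sub_mul_cayleyInv hb hw, h, div_div_div_cancel_right₀ hw,
    mul_div_cancel_left₀ _ two_ne_zero]

theorem norm_eq_one_of_mul_self (hb : b * b = 1) : ‖b‖ = 1 := by
  have : ‖b‖ * ‖b‖ = 1 := by rw [← norm_mul, hb, norm_one]
  nlinarith [norm_nonneg b]

/-- The formula shows at once that the disc goes to the half-plane and the circle, away from the
pole, to its edge. -/
theorem re_cayley (hb : b * b = 1) (z : ℂ) :
    (cayley b z).re = (1 - ‖z‖ ^ 2) / ‖1 - b * z‖ ^ 2 := by
  have h : ‖z‖ = ‖b * z‖ := by rw [norm_mul, norm_eq_one_of_mul_self hb, one_mul]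
  rw [h, cayley, Complex.div_re, ← add_div, Complex.sq_norm, Complex.sq_norm]
  congr 1
  simp only [Complex.normSq_apply, Complex.add_re, Complex.sub_re, Complex.add_im, Complex.sub_im,
    Complex.one_re, Complex.one_im]
  ring

theorem re_cayley_nonneg (hb : b * b = 1) {z : ℂ} (hz : ‖z‖ ≤ 1) : 0 ≤ (cayley b z).re := by
  rw [re_cayley hb]
  have : ‖z‖ ^ 2 ≤ 1 := pow_le_one₀ (norm_nonneg _) hz
  exact div_nonneg (by linarith) (by positivity)

theorem re_cayley_eq_zero_iff (hb : b * b = 1) {z : ℂ} (hz : 1 - b * z ≠ 0) :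
    (cayley b z).re = 0 ↔ ‖z‖ = 1 := by
  have : ‖1 - b * z‖ ^ 2 ≠ 0 := pow_ne_zero 2 (norm_ne_zero_iff.2 hz)
  rw [re_cayley hb, div_eq_zero_iff, or_iff_left this, sub_eq_zero, eq_comm,
    pow_eq_one_iff_of_nonneg (norm_nonneg _) two_ne_zero]

theorem norm_cayleyInv_le_one (hb : b * b = 1) {w : ℂ} (hw : 0 ≤ w.re) : ‖cayleyInv b w‖ ≤ 1 := by
  rw [cayleyInv, norm_mul, norm_eq_one_of_mul_self hb, one_mul, norm_div]
  refine div_le_one_of_le₀ (le_of_sq_le_sq ?_ (norm_nonneg _)) (norm_nonneg _)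
  rw [Complex.sq_norm, Complex.sq_norm]
  simp only [Complex.normSq_apply, Complex.add_re, Complex.sub_re, Complex.add_im, Complex.sub_im,
    Complex.one_re, Complex.one_im]
  linarith

theorem contDiffAt_cayley {z : ℂ} (hz : 1 - b * z ≠ 0) : ContDiffAt ℝ ∞ (cayley b) z := by
  have : ContDiffAt ℂ ∞ (cayley b) z := ContDiffAt.div (by fun_prop) (by fun_prop) hz
  exact this.restrict_scalars ℝ

theorem contDiffAt_cayleyInv {w : ℂ} (hw : w + 1 ≠ 0) : ContDiffAt ℝ ∞ (cayleyInv b) w := by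
  have : ContDiffAt ℂ ∞ (cayleyInv b) w :=
    contDiffAt_const.mul (ContDiffAt.div (by fun_prop) (by fun_prop) hw)
  exact this.restrict_scalars ℝ

end Cayley

/-! ### Charts, smooth structure and boundary of the disc. -/

namespace PlaneCoord

variable {P : Submodule ℝ E3} {c : E3} {r : ℝ} (C : PlaneCoord P c r) (hr : 0 < r) {b : ℂ}

/-- The chart of the closed disc that omits one boundary point. -/
def chart (hb : b * b = 1) : OpenPartialHomeomorph (discIn P c r) (EuclideanHalfSpace 2) where
  toFun p := ⟨planeIso (cayley b (C.coord p)), by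
    rw [planeIso_apply_zero]; exact re_cayley_nonneg hb (C.norm_coord_le_one hr p.2)⟩
  invFun h := ⟨C.param (cayleyInv b (planeIso.symm h.1)), C.param_mem_discIn hr
    (norm_cayleyInv_le_one hb (by rw [re_planeIso_symm]; exact h.2))⟩
  source := {p | 1 - b * C.coord p ≠ 0}
  target := univ
  map_source' _ _ := mem_univ _
  map_target' h _ := by
    simp only [mem_ofPred_eq, C.coord_param]
    exact one_sub_mul_cayleyInv_ne_zero hb
      (add_one_ne_zero_of_re_nonneg (by rw [re_planeIso_symm]; exact h.2))
  left_inv' p hp := Subtype.ext (by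
    simp only [planeIso.symm_apply_apply]
    rw [cayleyInv_cayley hb hp, C.param_coord _ p.2.1])
  right_inv' h _ := Subtype.ext (by
    simp only [C.coord_param]
    rw [cayley_cayleyInv hb
      (add_one_ne_zero_of_re_nonneg (by rw [re_planeIso_symm]; exact h.2)),
      planeIso.apply_symm_apply])
  open_source := by
    have : Continuous C.coord := C.contDiff_coord.continuous
    exact isOpen_ne_fun (by fun_prop) continuous_const
  open_target := isOpen_univ
  continuousOn_toFun := by
    refine (Topology.IsInducing.subtypeVal (t := {u : E2 | 0 ≤ u 0})).continuousOn_iff.2 ?_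
    intro p hp
    have h1 : Continuous fun p : discIn P c r => C.coord p :=
      C.contDiff_coord.continuous.comp continuous_subtype_val
    have h2 : ContinuousAt (cayley b) (C.coord p) := (contDiffAt_cayley hp).continuousAt
    exact (planeIso.continuous.continuousAt.comp
      (ContinuousAt.comp (f := fun p : discIn P c r => C.coord p) h2
        h1.continuousAt)).continuousWithinAt
  continuousOn_invFun := by
    rw [Topology.IsInducing.subtypeVal.continuousOn_iff]
    intro h _
    have h1 : Continuous fun h : EuclideanHalfSpace 2 => planeIso.symm h.1 :=
      planeIso.symm.continuous.comp continuous_subtype_val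
    have h2 : ContinuousAt (cayleyInv b) (planeIso.symm h.1) := (contDiffAt_cayleyInv
      (add_one_ne_zero_of_re_nonneg (by rw [re_planeIso_symm]; exact h.2))).continuousAt
    exact (C.contDiff_param.continuous.continuousAt.comp
      (ContinuousAt.comp (f := fun h : EuclideanHalfSpace 2 => planeIso.symm h.1) h2
        h1.continuousAt)).continuousWithinAt

theorem neg_one_mul_self : (-1 : ℂ) * -1 = 1 := by norm_num

open Classical in
/-- The closed disc as a surface with boundary, with two Cayley charts. -/
@[reducible]
def chartedSpace : ChartedSpace (EuclideanHalfSpace 2) (discIn P c r) where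
  atlas := {C.chart hr (one_mul 1), C.chart hr neg_one_mul_self}
  -- The chart with `b = 1` omits only the point of coordinate `1`, which the chart with `b = -1`
  -- contains.
  chartAt p := if C.coord p = 1 then C.chart hr neg_one_mul_self else C.chart hr (one_mul 1)
  mem_chart_source p := by
    split_ifs with h
    · simp [chart, h]
    · simpa [chart, sub_eq_zero, eq_comm (a := (1 : ℂ))] using h
  chart_mem_atlas p := by
    split_ifs <;> simp

theorem exists_of_mem_atlas {e : OpenPartialHomeomorph (discIn P c r) (EuclideanHalfSpace 2)}
    (he : e ∈ (C.chartedSpace hr).atlas) : ∃ (b : ℂ) (hb : b * b = 1), e = C.chart hr hb := by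
  rcases he with rfl | he
  · exact ⟨1, _, rfl⟩
  · exact ⟨-1, _, he⟩

/-- The smooth extension of the inverse of a chart. -/
def chartParam (b : ℂ) (u : E2) : E3 := C.param (cayleyInv b (planeIso.symm u))

theorem contDiffAt_chartParam {u : E2} (hu : 0 ≤ u 0) : ContDiffAt ℝ ∞ (C.chartParam b) u := by
  have h2 : ContDiffAt ℝ ∞ (cayleyInv b) (planeIso.symm u) := contDiffAt_cayleyInv
    (add_one_ne_zero_of_re_nonneg (by rw [re_planeIso_symm]; exact hu))
  exact C.contDiff_param.contDiffAt.comp u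
    (h2.comp u planeIso.symm.toContinuousLinearEquiv.contDiff.contDiffAt)

/-- The Cayley coordinate is a differentiable left inverse near `u`, even at edge points, because
`cayleyInv` is singular only at `-1`. -/
theorem injective_fderiv_chartParam (hb : b * b = 1) {u : E2} (hu : 0 ≤ u 0) :
    Function.Injective (fderiv ℝ (C.chartParam b) u) := by
  have hu1 : planeIso.symm u + 1 ≠ 0 :=
    add_one_ne_zero_of_re_nonneg (by rw [re_planeIso_symm]; exact hu)
  refine injective_of_hasFDerivAt_comp (g := fun p => planeIso (cayley b (C.coord p)))
    ((C.contDiffAt_chartParam hu).differentiableAt (by simp)).hasFDerivAt ?_ ?_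
  · have h1 : ContDiffAt ℝ ∞ (cayley b) (C.coord (C.chartParam b u)) := by
      apply contDiffAt_cayley
      rw [chartParam, C.coord_param]
      exact one_sub_mul_cayleyInv_ne_zero hb hu1
    have h2 : ContDiffAt ℝ ∞ (fun p => planeIso (cayley b (C.coord p))) (C.chartParam b u) :=
      planeIso.toContinuousLinearEquiv.contDiff.contDiffAt.comp _
        (h1.comp _ C.contDiff_coord.contDiffAt)
    exact h2.differentiableAt (by simp)
  · have h1 : Continuous fun u => planeIso.symm u + 1 :=
      planeIso.symm.continuous.add continuous_const
    filter_upwards [h1.continuousAt.eventually_ne hu1] with y hy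
    rw [chartParam, C.coord_param, cayley_cayleyInv hb hy, planeIso.apply_symm_apply]

theorem mem_range_iff {u : E2} : u ∈ range (𝓡∂ 2) ↔ 0 ≤ u 0 := by
  rw [range_modelWithCornersEuclideanHalfSpace]; rfl

theorem coe_chart_symm (hb : b * b = 1) {u : E2} (hu : u ∈ range (𝓡∂ 2)) :
    (((C.chart hr hb).symm ((𝓡∂ 2).symm u) : discIn P c r) : E3) = C.chartParam b u := by
  have : ((𝓡∂ 2).symm u : EuclideanHalfSpace 2).1 = u := (𝓡∂ 2).right_inv hu
  change C.param (cayleyInv b (planeIso.symm ((𝓡∂ 2).symm u : EuclideanHalfSpace 2).1)) = _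
  rw [this]
  rfl

theorem isManifold_disc :
    letI := C.chartedSpace hr
    IsManifold (𝓡∂ 2) ∞ (discIn P c r) := by
  let := C.chartedSpace hr
  refine isManifold_of_contDiffOn _ _ _ fun e e' he he' => ?_
  obtain ⟨b, hb, rfl⟩ := C.exists_of_mem_atlas hr he
  obtain ⟨b', hb', rfl⟩ := C.exists_of_mem_atlas hr he'
  have key : ∀ u ∈ range (𝓡∂ 2), ((𝓡∂ 2) ∘ ((C.chart hr hb).symm.trans (C.chart hr hb')) ∘
      (𝓡∂ 2).symm) u = planeIso (cayley b' (C.coord (C.chartParam b u))) := fun u hu => by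
    rw [← C.coe_chart_symm hr hb hu]; rfl
  refine ContDiffOn.congr (f := fun u => planeIso (cayley b' (C.coord (C.chartParam b u)))) ?_
    fun u hu => key u hu.2
  rintro u ⟨hu, hur⟩
  have hsrc : 1 - b' * C.coord (C.chartParam b u) ≠ 0 := by
    rw [← C.coe_chart_symm hr hb hur]
    exact hu.2
  have h1 : ContDiffAt ℝ ∞ (fun u => C.coord (C.chartParam b u)) u :=
    C.contDiff_coord.contDiffAt.comp u (C.contDiffAt_chartParam (mem_range_iff.1 hur))
  exact (planeIso.toContinuousLinearEquiv.contDiff.contDiffAt.comp u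
    (ContDiffAt.comp u (contDiffAt_cayley hsrc) h1)).contDiffWithinAt

theorem exists_chartAt_eq (p : discIn P c r) :
    letI := C.chartedSpace hr
    ∃ (b : ℂ) (hb : b * b = 1), chartAt (EuclideanHalfSpace 2) p = C.chart hr hb := by
  let := C.chartedSpace hr
  exact C.exists_of_mem_atlas hr (chart_mem_atlas _ p)

/-- This reduces one-sided derivatives of the inclusion to ordinary derivatives of `chartParam`,
which is smooth at every point of the closed half-plane. -/
theorem exists_localParam_eqOn (p : discIn P c r) :
    letI := C.chartedSpace hr
    ∃ b : ℂ, b * b = 1 ∧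
      EqOn (localParam (Subtype.val : discIn P c r → E3) p) (C.chartParam b) (range (𝓡∂ 2)) := by
  let := C.chartedSpace hr
  obtain ⟨b, hb, h⟩ := C.exists_chartAt_eq hr p
  refine ⟨b, hb, fun u hu => ?_⟩
  rw [← C.coe_chart_symm hr hb hu, ← h]
  rfl

theorem isSmoothImmersion_disc :
    letI := C.chartedSpace hr
    IsSmoothImmersion (Subtype.val : discIn P c r → E3) := by
  let := C.chartedSpace hr
  have hsm : ContMDiff (𝓡∂ 2) 𝓘(ℝ, E3) ∞ (Subtype.val : discIn P c r → E3) := fun p => by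
    obtain ⟨b, -, h⟩ := C.exists_localParam_eqOn hr p
    have hu : extChartAt (𝓡∂ 2) p p ∈ range (𝓡∂ 2) := mem_range_self _
    exact contMDiffAt_iff.2 ⟨continuous_subtype_val.continuousAt,
      (C.contDiffAt_chartParam (mem_range_iff.1 hu)).contDiffWithinAt.congr h (h hu)⟩
  refine ⟨hsm, fun p => ?_⟩
  obtain ⟨b, hb, h⟩ := C.exists_localParam_eqOn hr p
  have hu : extChartAt (𝓡∂ 2) p p ∈ range (𝓡∂ 2) := mem_range_self _
  rw [mfderiv_eq_fderivWithin_localParam hsm, fderivWithin_congr h (h hu),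
    ((C.contDiffAt_chartParam (mem_range_iff.1 hu)).differentiableAt (by simp)).fderivWithin
      ((𝓡∂ 2).uniqueDiffOn _ hu)]
  exact C.injective_fderiv_chartParam hb (mem_range_iff.1 hu)

theorem mem_boundary_disc_iff (p : discIn P c r) :
    letI := C.chartedSpace hr
    p ∈ (𝓡∂ 2).boundary (discIn P c r) ↔ (p : E3) ∈ circleIn P c r := by
  let := C.chartedSpace hr
  obtain ⟨b, hb, h⟩ := C.exists_chartAt_eq hr p
  have hsrc : 1 - b * C.coord p ≠ 0 := by
    have h1 := mem_chart_source (EuclideanHalfSpace 2) p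
    rw [h] at h1
    exact h1
  have happ : extChartAt (𝓡∂ 2) p p = planeIso (cayley b (C.coord p)) := by
    change (𝓡∂ 2) (chartAt (EuclideanHalfSpace 2) p p) = _
    rw [h]
    rfl
  change (𝓡∂ 2).IsBoundaryPoint p ↔ _
  rw [ModelWithCorners.isBoundaryPoint_iff, happ, frontier_range_modelWithCornersEuclideanHalfSpace,
    mem_ofPred_eq, planeIso_apply_zero, eq_comm, re_cayley_eq_zero_iff hb hsrc,
    C.mem_circleIn_iff hr p.2.1]

theorem spans_disc :
    letI := C.chartedSpace hr
    Spans (Subtype.val : discIn P c r → E3) (circleIn P c r) := by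
  let := C.chartedSpace hr
  refine Subset.antisymm ?_ fun p hp => ?_
  · rintro _ ⟨p, hp, rfl⟩
    exact (C.mem_boundary_disc_iff hr p).1 hp
  · exact ⟨⟨p, hp.1, hp.2.le⟩, (C.mem_boundary_disc_iff hr ⟨p, hp.1, hp.2.le⟩).2 hp, rfl⟩

end PlaneCoord

theorem isCompact_discIn (P : Submodule ℝ E3) (c : E3) (r : ℝ) : IsCompact (discIn P c r) :=
  (isCompact_closedBall c r).inter_left P.closed_of_finiteDimensional

theorem isConnected_discIn {P : Submodule ℝ E3} {c : E3} (hc : c ∈ P) {r : ℝ} (hr : 0 < r) :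
    IsConnected (discIn P c r) :=
  ⟨⟨c, hc, by simpa using hr.le⟩, (P.convex.inter (convex_closedBall c r)).isPreconnected⟩

theorem isCompactStationarySurface_disc {P : Submodule ℝ E3} (hP : Module.finrank ℝ P = 2) {c : E3}
    (hc : c ∈ P) {r : ℝ} (hr : 0 < r) (h0 : (0 : E3) ∉ discIn P c r) (C : PlaneCoord P c r) (α : ℝ) :
    letI := C.chartedSpace hr
    IsCompactStationarySurface α (Subtype.val : discIn P c r → E3) := by
  let := C.chartedSpace hr
  exact
    { isManifold := C.isManifold_disc hr
      t2 := inferInstance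
      compact := isCompact_iff_compactSpace.1 (isCompact_discIn P c r)
      connected := isConnected_iff_connectedSpace.1 (isConnected_discIn hc hr)
      immersion := C.isSmoothImmersion_disc hr
      stationary := isStationary_of_mem_plane hP (C.isSmoothImmersion_disc hr) (fun p => p.2.1)
        (fun p h => h0 (h ▸ p.2)) α }

end

end StationarySurface

open StationarySurface in
theorem mainTheorem9 (P : Submodule ℝ E3) (hP : Module.finrank ℝ P = 2)
    (c : E3) (hc : c ∈ P) (r : ℝ) (hr : 0 < r) (h0 : (0 : E3) ∉ discIn P c r) :
    (∃ _ : ChartedSpace (EuclideanHalfSpace 2) (discIn P c r),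
      IsCompactStationarySurface (-4) (Subtype.val : discIn P c r → E3) ∧
        Spans (Subtype.val : discIn P c r → E3) (circleIn P c r)) ∧
    (∀ (M : Type*) [TopologicalSpace M] [ChartedSpace (EuclideanHalfSpace 2) M] (X : M → E3),
      IsCompactStationarySurface (-4) X → Spans X (circleIn P c r) →
        Function.Injective X ∧ Set.range X = discIn P c r) := by
  obtain ⟨C⟩ := nonempty_planeCoord hP hc hr
  refine ⟨⟨C.chartedSpace hr, isCompactStationarySurface_disc hP hc hr h0 C (-4), C.spans_disc hr⟩,
    fun M _ _ X hX hs => ?_⟩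
  have := hX.t2
  have := hX.compact
  have := hX.connected
  exact injective_and_range_eq_discIn hP hc hr hX.isManifold hX.immersion hs
    (mem_discIn_of_spans hX hs hr (lt_norm_of_zero_notMem h0))
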